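/- **Setting.** Let $\tau:\mathbb{R}\to\mathbb{R}$ be measurable, $\sigma_w,\sigma_b\in\mathbb{R}$, and let $L\ge 0$ be an integer (the number of hidden layers). Let $Z,W$ be independent standard Gaussian variables. Define $Q_1=\sigma_w^2+\sigma_b^2$, $F_1(t)=(\sigma_w^2t+\sigma_b^2)/(\sigma_w^2+\sigma_b^2)$ and, for $2\le l\le L+1$ and $t\in[-1,1]$, $$Q_l=\sigma_w^2\,\mathbb{E}\big[\tau(\sqrt{Q_{l-1}}\,Z)^2\big]+\sigma_b^2,$$ $$Q_lF_l(t)=\sigma_w^2\,\mathbb{E}\Big[\tau(\sqrt{Q_{l-1}}Z)\,\tau\big(\sqrt{Q_{l-1}}\,(F_{l-1}(t)Z+\sqrt{1-F_{l-1}(t)^2}\,W)\big)\Big]+\sigma_b^2 .$$ Assume that $\mathbb{E}[\tau(\sqrt{Q_l}Z)^2]<\infty$ for $1\le l\le L$, and put $Q=Q_{L+1}$, $F=F_{L+1}$; assume $Q>0$. (For an intermediate layer with $Q_l=0$ the value of $F_l$ is immaterial.) Assume moreover that $\tau$ is Lipschitz continuous (as are the ReLU and $\tanh$), or, for more general $\tau$,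 that $F$ has a finite one-sided derivative $F'(1)$ at $1$. The output of the random deep neural network on $n$ bits, in the Gaussian process approximation, is a Gaussian process $(\phi(x))_{x\in\{-1,1\}^n}$ on a probability space with $\mathbb{E}\,\phi(x)=0$ and $\mathbb{E}\,\phi(x)\phi(y)=Q\,F(x\cdot y/n)$ for all $x,y\in\{-1,1\}^n$. A sequence $x^{(0)},\ldots,x^{(n)}\in\{-1,1\}^n$ is geodesic if the Hamming distance of $x^{(i)}$ and $x^{(j)}$ is $|i-j|$ for all $i,j$. Put $$h_n=\mathbb{E}\Big(\min\big\{\min\{1\le i\le n:\phi(x^{(0)})\,\phi(x^{(i)})<0\},\,n\big\}\Big),\qquad \min\emptyset=\infty .$$ **Theorem (random bit flips).** There is a constant $t_0>0$, depending only on the function $F:[-1,1]\to\mathbb{R}$ (so not on $n$, on $Q$, on the geodesic sequence, on the probability space, nor on $\tau,L,\sigma_w,\sigma_b$ other than through $F$), such that $h_n\ge n\,t_0$ for every $n\in\mathbb{N}$, every such output $\phi$ and every geodesic sequence $x^{(0)},\ldots,x^{(n)}$. -/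

import Mathlib

open MeasureTheory ProbabilityTheory
open scoped NNReal

/-- Variance of a preactivation of a random network with activation `τ`, weight variance
`σw ^ 2 / (fan-in)` and bias variance `σb ^ 2`, in the Gaussian process limit, for inputs of
squared norm equal to the input dimension. Index `l` stands for the layer number `l + 1`:
index `0` is the first layer, and the output of a network with `L` hidden layers has index `L`. -/
noncomputable def netVar (τ : ℝ → ℝ) (σw σb : ℝ) : ℕ → ℝ
  | 0 => σw ^ 2 + σb ^ 2
  | l + 1 =>
      σw ^ 2 * (∫ z, τ (√(netVar τ σw σb l) * z) ^ 2 ∂(gaussianReal 0 1)) + σb ^ 2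

/-- Correlation coefficient of the preactivations generated by two inputs `x`, `y` of squared
norm `n`, as a function of `t = x ⬝ y / n`; same indexing of the layers as in `netVar`. -/
noncomputable def netCorr (τ : ℝ → ℝ) (σw σb : ℝ) : ℕ → ℝ → ℝ
  | 0, t => (σw ^ 2 * t + σb ^ 2) / (σw ^ 2 + σb ^ 2)
  | l + 1, t =>
      (σw ^ 2 * (∫ p : ℝ × ℝ,
          τ (√(netVar τ σw σb l) * p.1) *
          τ (√(netVar τ σw σb l) *
            (netCorr τ σw σb l t * p.1 + √(1 - netCorr τ σw σb l t ^ 2) * p.2))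
          ∂((gaussianReal 0 1).prod (gaussianReal 0 1))) + σb ^ 2) /
        netVar τ σw σb (l + 1)

/-- Bit strings of length `n`, with bits in `{-1, 1} = ℤˣ`. -/
abbrev BitString (n : ℕ) : Type := Fin n → ℤˣ

/-- The normalized scalar product `x ⬝ y / n` of two bit strings. -/
noncomputable def overlap {n : ℕ} (x y : BitString n) : ℝ :=
  (∑ i, ((x i : ℤ) : ℝ) * ((y i : ℤ) : ℝ)) / n

/-- `φ` is the output, on bit strings of length `n`, of a random network with `L` hidden layers
in the Gaussian process limit: a centred Gaussian process with covariance
`Q * F (x ⬝ y / n)`, where `Q = netVar τ σw σb L` and `F = netCorr τ σw σb L`. -/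
structure IsNetworkOutput (τ : ℝ → ℝ) (σw σb : ℝ) (L n : ℕ) {Ω : Type*} [MeasurableSpace Ω]
    (P : Measure Ω) (φ : BitString n → Ω → ℝ) : Prop where
  gaussian : IsGaussianProcess φ P
  mean_zero : ∀ x, ∫ ω, φ x ω ∂P = 0
  cov : ∀ x y, ∫ ω, φ x ω * φ y ω ∂P = netVar τ σw σb L * netCorr τ σw σb L (overlap x y)

/-- A sequence `x 0, …, x n` of bit strings of length `n` is geodesic if the Hamming distance of
`x i` and `x j` is `|i - j|`. -/
def IsGeodesic {n : ℕ} (x : Fin (n + 1) → BitString n) : Prop :=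
  ∀ i j, (hammingDist (x i) (x j) : ℤ) = |(i : ℤ) - (j : ℤ)|

/-- `min {min {1 ≤ i ≤ n : v 0 * v i < 0}, n}`, which is `n` if no such `i` exists. -/
noncomputable def stepsToFlip {n : ℕ} (v : Fin (n + 1) → ℝ) : ℕ :=
  sInf (insert n {k | ∃ i : Fin (n + 1), (i : ℕ) = k ∧ 1 ≤ k ∧ v 0 * v i < 0})

/-! Along a geodesic, `i` bit flips lower the overlap by `2 * i / n`. Since `1 - F t ≤ C * (1 - t)`
near `t = 1` (`exists_one_sub_netCorr_le`), an increment of `φ` over lag `d` has variance at most `4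
* C * Q * d / n`, as for Brownian motion run for time `d / n`. Being Gaussian, it has fourth moment
of order `d ^ 2`, and this exponent exceeds 1, so dyadic chaining controls the running maximum
(`measureReal_exists_increment_ge_le`). Up to a time of order `ε * n` the process thus moves less
than `√Q / 4` with probability at least 3/4, while the initial value exceeds that size with
probability at least 3/4. With probability at least 1/2 no flip occurs by then, so the mean is of
order `n`. The scale `Q` cancels and `ε` depends only on `C` and the range of the linear bound,
hence only on `F`. -/

/-! ### Chaining and one-dimensional Gaussian estimates -/

/-- Dyadic maximal inequality for processes whose increments have tails `D * d ^ 2 / a ^ 4`. -/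
theorem measureReal_exists_increment_ge_le {Ω : Type*} [MeasurableSpace Ω] {P : Measure Ω}
    [IsFiniteMeasure P] {f : ℕ → Ω → ℝ} {D : ℝ} (hD : 0 ≤ D) (K : ℕ)
    (h : ∀ i d : ℕ, d ≤ 2 ^ K → ∀ a : ℝ, 0 < a →
      P.real {ω | a ≤ |f (i + d) ω - f i ω|} ≤ D * d ^ 2 / a ^ 4)
    (s : ℕ) {a : ℝ} (ha : 0 < a) :
    P.real {ω | ∃ i < 2 ^ K, a ≤ |f (s + i) ω - f s ω|} ≤ 20000 * D * 4 ^ K / a ^ 4 := by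
  induction K generalizing s a with
  | zero =>
    have : {ω | ∃ i < 2 ^ 0, a ≤ |f (s + i) ω - f s ω|} = ∅ := by
      ext ω
      simp [ha]
    rw [this]
    simp only [measureReal_empty]
    positivity
  | succ K ih =>
    have h' : ∀ i d : ℕ, d ≤ 2 ^ K → ∀ a : ℝ, 0 < a →
        P.real {ω | a ≤ |f (i + d) ω - f i ω|} ≤ D * d ^ 2 / a ^ 4 := fun i d hd =>
      h i d (hd.trans (Nat.pow_le_pow_right two_pos K.le_succ))
    -- Each half gets threshold `9 / 10 * a`, the jump between them `a / 10`. The induction closes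
    -- because `2 * (10 / 9) ^ 4 < 4`; the slack, times 20000, absorbs the `10 ^ 4` from the jump.
    have hb : 0 < 9 / 10 * a := by positivity
    have hsub : {ω | ∃ i < 2 ^ (K + 1), a ≤ |f (s + i) ω - f s ω|} ⊆
        ({ω | ∃ i < 2 ^ K, 9 / 10 * a ≤ |f (s + i) ω - f s ω|} ∪
          {ω | ∃ i < 2 ^ K, 9 / 10 * a ≤ |f (s + 2 ^ K + i) ω - f (s + 2 ^ K) ω|}) ∪
          {ω | a / 10 ≤ |f (s + 2 ^ K) ω - f s ω|} := by
      rintro ω ⟨i, hi, hai⟩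
      by_cases hiK : i < 2 ^ K
      · exact Or.inl (Or.inl ⟨i, hiK, by linarith⟩)
      · obtain ⟨j, rfl⟩ := Nat.exists_eq_add_of_le (not_lt.1 hiK)
        by_cases hj : a / 10 ≤ |f (s + 2 ^ K) ω - f s ω|
        · exact Or.inr hj
        · refine Or.inl (Or.inr ⟨j, by rw [pow_succ] at hi; omega, ?_⟩)
          have htri := abs_sub_le (f (s + 2 ^ K + j) ω) (f (s + 2 ^ K) ω) (f s ω)
          rw [add_assoc] at htri ⊢
          linarith
    have h1 := ih h' s hb
    have h2 := ih h' (s + 2 ^ K) hb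
    have h3 := h' s (2 ^ K) le_rfl (a / 10) (by positivity)
    have hle := (measureReal_mono hsub (measure_ne_top P _)).trans
      ((measureReal_union_le _ _).trans (add_le_add_left (measureReal_union_le _ _) _))
    refine hle.trans ((add_le_add (add_le_add h1 h2) h3).trans ?_)
    have e : ((2 ^ K : ℕ) : ℝ) ^ 2 = 4 ^ K := by
      push_cast
      rw [← pow_mul, mul_comm, pow_mul]
      norm_num
    rw [e]
    have hX : 0 ≤ D * 4 ^ K / a ^ 4 := by positivity
    have e1 : 20000 * D * 4 ^ K / (9 / 10 * a) ^ 4 =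
        (20000 * (10 / 9) ^ 4) * (D * 4 ^ K / a ^ 4) := by
      field_simp
    have e2 : D * 4 ^ K / (a / 10) ^ 4 = 10000 * (D * 4 ^ K / a ^ 4) := by
      field_simp
      norm_num
    have e3 : 20000 * D * 4 ^ (K + 1) / a ^ 4 = 80000 * (D * 4 ^ K / a ^ 4) := by
      rw [pow_succ]
      ring
    rw [e1, e2, e3]
    nlinarith

theorem integral_pow_four_gaussianReal (v : ℝ≥0) :
    ∫ z, z ^ 4 ∂(gaussianReal 0 v) = (v : ℝ) ^ 2 * ∫ z, z ^ 4 ∂(gaussianReal 0 1) := by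
  have hmap : gaussianReal 0 v = (gaussianReal 0 1).map (√(v : ℝ) * ·) := by
    rw [gaussianReal_map_const_mul]
    congr 1
    · simp
    · ext
      simp
  rw [hmap, integral_map (by fun_prop) (by fun_prop), ← integral_const_mul]
  congr 1 with z
  have : √(v : ℝ) ^ 4 = (v : ℝ) ^ 2 := by
    rw [show (4 : ℕ) = 2 * 2 from rfl, pow_mul, Real.sq_sqrt v.coe_nonneg]
  rw [mul_pow, this]

/-- Markov's inequality for the fourth power; Chebyshev's would give a tail only linear in the lag,
too weak for chaining. -/
theorem measureReal_abs_ge_le_of_hasGaussianLaw {Ω : Type*} [MeasurableSpace Ω] {P : Measure Ω}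
    {Y : Ω → ℝ} (hY : HasGaussianLaw Y P) (h0 : ∫ ω, Y ω ∂P = 0) {a : ℝ} (ha : 0 < a) :
    P.real {ω | a ≤ |Y ω|} ≤
      (∫ z, z ^ 4 ∂(gaussianReal 0 1)) * (∫ ω, Y ω ^ 2 ∂P) ^ 2 / a ^ 4 := by
  have := hY.isProbabilityMeasure
  have hmap := hY.map_eq_gaussianReal
  rw [h0, variance_of_integral_eq_zero hY.aemeasurable h0] at hmap
  have h4 : ∫ ω, Y ω ^ 4 ∂P =
      (∫ ω, Y ω ^ 2 ∂P) ^ 2 * ∫ z, z ^ 4 ∂(gaussianReal 0 1) := by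
    rw [← integral_map (φ := Y) (f := fun z : ℝ => z ^ 4) hY.aemeasurable (by fun_prop), hmap,
      integral_pow_four_gaussianReal, Real.coe_toNNReal _ (by positivity)]
  have hint : Integrable (fun ω => Y ω ^ 4) P := by
    have := (hY.memLp (p := 4) (by simp)).integrable_norm_pow (by norm_num)
    simpa only [Real.norm_eq_abs, (by decide : Even 4).pow_abs] using this
  have hm := mul_meas_ge_le_integral_of_nonneg (ae_of_all P fun ω => by positivity) hint (a ^ 4)
  have hset : {ω | a ≤ |Y ω|} = {ω | a ^ 4 ≤ Y ω ^ 4} := by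
    ext ω
    change a ≤ |Y ω| ↔ a ^ 4 ≤ Y ω ^ 4
    rw [← pow_le_pow_iff_left₀ ha.le (abs_nonneg _) (n := 4) (by norm_num),
      (by decide : Even 4).pow_abs]
  rw [hset, le_div_iff₀ (by positivity), mul_comm]
  rw [h4] at hm
  linarith

/-- The density is at most `1 / (2 * √Q)`, as `2 * π ≥ 4`, and the interval has length `2 * c * √Q`.
-/
theorem measureReal_abs_lt_le_of_hasGaussianLaw {Ω : Type*} [MeasurableSpace Ω] {P : Measure Ω}
    {Y : Ω → ℝ} (hY : HasGaussianLaw Y P) (h0 : ∫ ω, Y ω ∂P = 0) {Q : ℝ} (hQ : 0 < Q)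
    (h2 : ∫ ω, Y ω ^ 2 ∂P = Q) {c : ℝ} (hc : 0 ≤ c) :
    P.real {ω | |Y ω| < c * √Q} ≤ c := by
  have := hY.isProbabilityMeasure
  have hmap := hY.map_eq_gaussianReal
  rw [h0, variance_of_integral_eq_zero hY.aemeasurable h0, h2] at hmap
  set v := Q.toNNReal
  have hv : v ≠ 0 := by simpa [v] using hQ
  have hvQ : (v : ℝ) = Q := Real.coe_toNNReal _ hQ.le
  have hpdf : ∀ z, gaussianPDFReal 0 v z ≤ (2 * √Q)⁻¹ := by
    intro z
    rw [gaussianPDFReal, hvQ]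
    have h1 : (√(2 * Real.pi * Q))⁻¹ ≤ (2 * √Q)⁻¹ := by
      apply inv_anti₀ (by positivity)
      apply Real.le_sqrt_of_sq_le
      rw [mul_pow, Real.sq_sqrt hQ.le]
      nlinarith [Real.pi_gt_three]
    have h3 : Real.exp (-(z - 0) ^ 2 / (2 * Q)) ≤ 1 := by
      apply Real.exp_le_one_iff.2
      apply div_nonpos_of_nonpos_of_nonneg <;> nlinarith [sq_nonneg (z - 0)]
    calc _ ≤ (√(2 * Real.pi * Q))⁻¹ * 1 := by gcongr
      _ ≤ _ := by simpa using h1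
  have hset : {ω | |Y ω| < c * √Q} = Y ⁻¹' Set.Ioo (-(c * √Q)) (c * √Q) := by
    ext ω
    simp [abs_lt]
  rw [hset, ← map_measureReal_apply_of_aemeasurable hY.aemeasurable measurableSet_Ioo, hmap,
    measureReal_def, gaussianReal_apply_eq_integral _ hv, ENNReal.toReal_ofReal
      (integral_nonneg fun z => gaussianPDFReal_nonneg _ _ _)]
  calc ∫ z in Set.Ioo (-(c * √Q)) (c * √Q), gaussianPDFReal 0 v z
      ≤ ∫ z in Set.Ioo (-(c * √Q)) (c * √Q), (2 * √Q)⁻¹ := by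
        apply integral_mono ((integrable_gaussianPDFReal _ _).integrableOn) _ hpdf
        exact integrableOn_const (by simp)
    _ = c := by
        rw [setIntegral_const, measureReal_def, Real.volume_Ioo, ENNReal.toReal_ofReal (by
          have : 0 ≤ c * √Q := by positivity
          linarith), smul_eq_mul]
        field_simp
        ring

/-! ### Correlated pairs of standard Gaussians -/

theorem measurePreserving_correlated_gaussianReal {ρ : ℝ} (hρ : |ρ| ≤ 1) :
    MeasurePreserving (fun p : ℝ × ℝ => ρ * p.1 + √(1 - ρ ^ 2) * p.2)
      ((gaussianReal 0 1).prod (gaussianReal 0 1)) (gaussianReal 0 1) := by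
  refine ⟨by fun_prop, ?_⟩
  have hind : IndepFun (fun p : ℝ × ℝ => ρ * p.1) (fun p : ℝ × ℝ => √(1 - ρ ^ 2) * p.2)
      ((gaussianReal 0 1).prod (gaussianReal 0 1)) :=
    indepFun_prod (X := fun z : ℝ => ρ * z) (Y := fun z : ℝ => √(1 - ρ ^ 2) * z)
      (by fun_prop) (by fun_prop)
  have hX : ((gaussianReal 0 1).prod (gaussianReal 0 1)).map (fun p : ℝ × ℝ => ρ * p.1) =
      gaussianReal (ρ * 0) (.mk (ρ ^ 2) (sq_nonneg ρ) * 1) := by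
    rw [← gaussianReal_map_const_mul]
    conv_rhs => rw [← (measurePreserving_fst (μ := gaussianReal 0 1) (ν := gaussianReal 0 1)).map_eq]
    rw [Measure.map_map (by fun_prop) (by fun_prop)]
    rfl
  have hY : ((gaussianReal 0 1).prod (gaussianReal 0 1)).map
      (fun p : ℝ × ℝ => √(1 - ρ ^ 2) * p.2) =
      gaussianReal (√(1 - ρ ^ 2) * 0) (.mk (√(1 - ρ ^ 2) ^ 2) (sq_nonneg _) * 1) := by
    rw [← gaussianReal_map_const_mul]
    conv_rhs => rw [← (measurePreserving_snd (μ := gaussianReal 0 1) (ν := gaussianReal 0 1)).map_eq]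
    rw [Measure.map_map (by fun_prop) (by fun_prop)]
    rfl
  have h := gaussianReal_add_gaussianReal_of_indepFun hind hX hY
  change Measure.map ((fun p : ℝ × ℝ => ρ * p.1) + fun p : ℝ × ℝ => √(1 - ρ ^ 2) * p.2) _ = _
  rw [h]
  congr 1
  · simp
  · ext
    have : ρ ^ 2 ≤ 1 := (sq_le_one_iff_abs_le_one _).2 hρ
    simp [Real.sq_sqrt (sub_nonneg.2 this)]

theorem memLp_two_fst_gaussianReal {g : ℝ → ℝ} (hg : MemLp g 2 (gaussianReal 0 1)) :
    MemLp (fun p : ℝ × ℝ => g p.1) 2 ((gaussianReal 0 1).prod (gaussianReal 0 1)) :=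
  hg.comp_measurePreserving measurePreserving_fst

theorem memLp_two_correlated_gaussianReal {g : ℝ → ℝ} (hg : MemLp g 2 (gaussianReal 0 1))
    {ρ : ℝ} (hρ : |ρ| ≤ 1) :
    MemLp (fun p : ℝ × ℝ => g (ρ * p.1 + √(1 - ρ ^ 2) * p.2)) 2
      ((gaussianReal 0 1).prod (gaussianReal 0 1)) :=
  hg.comp_measurePreserving (measurePreserving_correlated_gaussianReal hρ)

theorem integral_sq_add_mul_correlated {g : ℝ → ℝ} (hg : MemLp g 2 (gaussianReal 0 1)) {ρ : ℝ}
    (hρ : |ρ| ≤ 1) (c : ℝ) :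
    ∫ p : ℝ × ℝ, (g p.1 + c * g (ρ * p.1 + √(1 - ρ ^ 2) * p.2)) ^ 2
        ∂((gaussianReal 0 1).prod (gaussianReal 0 1)) =
      (1 + c ^ 2) * ∫ z, g z ^ 2 ∂(gaussianReal 0 1) +
      2 * c * ∫ p : ℝ × ℝ, g p.1 * g (ρ * p.1 + √(1 - ρ ^ 2) * p.2)
        ∂((gaussianReal 0 1).prod (gaussianReal 0 1)) := by
  have hU := memLp_two_fst_gaussianReal hg
  have hV := memLp_two_correlated_gaussianReal hg hρ
  have hm := measurePreserving_correlated_gaussianReal hρ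
  have hsq : AEStronglyMeasurable (fun z => g z ^ 2) (gaussianReal 0 1) :=
    hg.integrable_sq.aestronglyMeasurable
  have eU : ∫ p : ℝ × ℝ, g p.1 ^ 2 ∂((gaussianReal 0 1).prod (gaussianReal 0 1)) =
      ∫ z, g z ^ 2 ∂(gaussianReal 0 1) := by
    rw [integral_fun_fst (fun z => g z ^ 2)]
    simp
  have eV : ∫ p : ℝ × ℝ, g (ρ * p.1 + √(1 - ρ ^ 2) * p.2) ^ 2
      ∂((gaussianReal 0 1).prod (gaussianReal 0 1)) = ∫ z, g z ^ 2 ∂(gaussianReal 0 1) := by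
    conv_rhs => rw [← hm.map_eq]
    rw [integral_map hm.aemeasurable (by rwa [hm.map_eq])]
  have hUV : Integrable (fun p : ℝ × ℝ => g p.1 * g (ρ * p.1 + √(1 - ρ ^ 2) * p.2))
      ((gaussianReal 0 1).prod (gaussianReal 0 1)) := hU.integrable_mul hV
  have hexp : ∀ p : ℝ × ℝ, (g p.1 + c * g (ρ * p.1 + √(1 - ρ ^ 2) * p.2)) ^ 2 =
      (g p.1 ^ 2 + c ^ 2 * g (ρ * p.1 + √(1 - ρ ^ 2) * p.2) ^ 2) +
        2 * c * (g p.1 * g (ρ * p.1 + √(1 - ρ ^ 2) * p.2)) := fun p => by ring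
  simp_rw [hexp]
  rw [integral_add (by exact hU.integrable_sq.add (hV.integrable_sq.const_mul _)) (hUV.const_mul _),
    integral_add hU.integrable_sq (hV.integrable_sq.const_mul _), integral_const_mul,
    integral_const_mul, eU, eV]
  ring

theorem abs_integral_mul_correlated_le {g : ℝ → ℝ} (hg : MemLp g 2 (gaussianReal 0 1)) {ρ : ℝ}
    (hρ : |ρ| ≤ 1) :
    |∫ p : ℝ × ℝ, g p.1 * g (ρ * p.1 + √(1 - ρ ^ 2) * p.2)
        ∂((gaussianReal 0 1).prod (gaussianReal 0 1))| ≤ ∫ z, g z ^ 2 ∂(gaussianReal 0 1) := by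
  have h (c : ℝ) := (integral_sq_add_mul_correlated hg hρ c).symm.trans_ge
    (integral_nonneg fun p => sq_nonneg _)
  have h1 := h 1
  have h2 := h (-1)
  rw [abs_le]
  constructor <;> linarith

theorem integral_sq_gaussianReal_one : ∫ z : ℝ, z ^ 2 ∂(gaussianReal 0 1) = 1 := by
  have := variance_fun_id_gaussianReal (μ := 0) (v := 1)
  rwa [variance_of_integral_eq_zero (by fun_prop) integral_id_gaussianReal] at this

theorem integral_mul_correlated_id (ρ : ℝ) :
    ∫ p : ℝ × ℝ, p.1 * (ρ * p.1 + √(1 - ρ ^ 2) * p.2)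
        ∂((gaussianReal 0 1).prod (gaussianReal 0 1)) = ρ := by
  have hid : MemLp (fun z : ℝ => z) 2 (gaussianReal 0 1) := memLp_id_gaussianReal 2
  have hexp : ∀ p : ℝ × ℝ, p.1 * (ρ * p.1 + √(1 - ρ ^ 2) * p.2) =
      ρ * p.1 ^ 2 + √(1 - ρ ^ 2) * (p.1 * p.2) := fun p => by ring
  have hI : Integrable (fun z : ℝ => z) (gaussianReal 0 1) := hid.integrable one_le_two
  simp_rw [hexp]
  rw [integral_add ((memLp_two_fst_gaussianReal hid).integrable_sq.const_mul _)
    ((hI.mul_prod hI).const_mul _), integral_const_mul, integral_const_mul,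
    integral_prod_mul (fun z : ℝ => z) (fun z : ℝ => z), integral_id_gaussianReal,
    integral_fun_fst (fun z : ℝ => z ^ 2)]
  simp [integral_sq_gaussianReal_one]

/-- The left side is half the mean square of the difference of `g` at the two correlated variables.
The Lipschitz bound compares it with the case `g = id`, where the correlation is exactly `ρ`. -/
theorem integral_sq_sub_mul_correlated_le {g : ℝ → ℝ} (hg : MemLp g 2 (gaussianReal 0 1))
    {κ : ℝ} (hκ : ∀ a b, |g a - g b| ≤ κ * |a - b|) {ρ : ℝ} (hρ : |ρ| ≤ 1) :
    ∫ z, g z ^ 2 ∂(gaussianReal 0 1) - ∫ p : ℝ × ℝ, g p.1 * g (ρ * p.1 + √(1 - ρ ^ 2) * p.2)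
        ∂((gaussianReal 0 1).prod (gaussianReal 0 1)) ≤ κ ^ 2 * (1 - ρ) := by
  have hid : MemLp (fun z : ℝ => z) 2 (gaussianReal 0 1) := memLp_id_gaussianReal 2
  have h1 := integral_sq_add_mul_correlated hg hρ (-1)
  have h2 := integral_sq_add_mul_correlated hid hρ (-1)
  rw [integral_mul_correlated_id, integral_sq_gaussianReal_one] at h2
  have hle : ∫ p : ℝ × ℝ, (g p.1 + -1 * g (ρ * p.1 + √(1 - ρ ^ 2) * p.2)) ^ 2
        ∂((gaussianReal 0 1).prod (gaussianReal 0 1)) ≤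
      ∫ p : ℝ × ℝ, κ ^ 2 * (p.1 + -1 * (ρ * p.1 + √(1 - ρ ^ 2) * p.2)) ^ 2
        ∂((gaussianReal 0 1).prod (gaussianReal 0 1)) := by
    apply integral_mono
    · exact ((memLp_two_fst_gaussianReal hg).add
        ((memLp_two_correlated_gaussianReal hg hρ).const_mul (-1))).integrable_sq
    · exact ((memLp_two_fst_gaussianReal hid).add
        ((memLp_two_correlated_gaussianReal hid hρ).const_mul (-1))).integrable_sq.const_mul _
    · intro p
      have h := hκ p.1 (ρ * p.1 + √(1 - ρ ^ 2) * p.2)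
      have := pow_le_pow_left₀ (abs_nonneg _) h 2
      rw [mul_pow, sq_abs, sq_abs] at this
      simpa only [neg_one_mul, ← sub_eq_add_neg] using this
  rw [integral_const_mul, h1, h2] at hle
  linarith

/-! ### The correlation function near `1` -/

theorem netVar_nonneg (τ : ℝ → ℝ) (σw σb : ℝ) (l : ℕ) : 0 ≤ netVar τ σw σb l := by
  cases l with
  | zero => rw [netVar]; positivity
  | succ l =>
    rw [netVar]
    have : 0 ≤ ∫ z, τ (√(netVar τ σw σb l) * z) ^ 2 ∂(gaussianReal 0 1) :=
      integral_nonneg fun z => sq_nonneg _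
    positivity

theorem netCorr_one {τ : ℝ → ℝ} {σw σb : ℝ} {l : ℕ} (h : 0 < netVar τ σw σb l) :
    netCorr τ σw σb l 1 = 1 := by
  induction l with
  | zero =>
    rw [netVar] at h
    rw [netCorr, mul_one, div_self h.ne']
  | succ l ih =>
    have key : ∀ p : ℝ × ℝ, √(netVar τ σw σb l) *
        (netCorr τ σw σb l 1 * p.1 + √(1 - netCorr τ σw σb l 1 ^ 2) * p.2) =
        √(netVar τ σw σb l) * p.1 := by
      intro p
      -- If the previous layer has variance zero, its correlation is a junk value, but the factor
      -- `√0` removes it.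
      rcases (netVar_nonneg τ σw σb l).eq_or_lt with h0 | h0
      · simp [← h0]
      · simp [ih h0]
    rw [netCorr]
    simp_rw [key, ← sq]
    rw [integral_fun_fst (fun z => τ (√(netVar τ σw σb l) * z) ^ 2), div_eq_one_iff_eq h.ne', netVar]
    simp

theorem abs_netCorr_le_one {τ : ℝ → ℝ} {σw σb : ℝ} {L : ℕ}
    (hτ : ∀ l < L, MemLp (fun z => τ (√(netVar τ σw σb l) * z)) 2 (gaussianReal 0 1))
    {t : ℝ} (ht : |t| ≤ 1) {l : ℕ} (hl : l ≤ L) : |netCorr τ σw σb l t| ≤ 1 := by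
  induction l with
  | zero =>
    rw [netCorr, abs_div, abs_of_nonneg (by positivity : 0 ≤ σw ^ 2 + σb ^ 2)]
    apply div_le_one_of_le₀ _ (by positivity)
    rw [abs_le] at ht ⊢
    constructor <;> nlinarith [sq_nonneg σw, sq_nonneg σb]
  | succ l ih =>
    have h := abs_integral_mul_correlated_le (hτ l (by omega)) (ih (by omega))
    rw [netCorr, abs_div, abs_of_nonneg (netVar_nonneg _ _ _ (l + 1))]
    apply div_le_one_of_le₀ _ (netVar_nonneg _ _ _ (l + 1))
    rw [netVar, abs_le] at *
    constructor <;> nlinarith [sq_nonneg σw, sq_nonneg σb]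

/-- A Lipschitz layer multiplies the defect `1 - netCorr` by at most a constant, so linearity
propagates from the affine first layer. -/
theorem LipschitzWith.exists_one_sub_netCorr_le {τ : ℝ → ℝ} {σw σb : ℝ} {L : ℕ} {K : ℝ≥0}
    (hK : LipschitzWith K τ)
    (hτ : ∀ l < L, MemLp (fun z => τ (√(netVar τ σw σb l) * z)) 2 (gaussianReal 0 1))
    {l : ℕ} (hl : l ≤ L) (hQ : 0 < netVar τ σw σb l) :
    ∃ C : ℝ, ∀ t : ℝ, |t| ≤ 1 → 1 - netCorr τ σw σb l t ≤ C * (1 - t) := by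
  induction l with
  | zero =>
    refine ⟨σw ^ 2 / (σw ^ 2 + σb ^ 2), fun t _ => le_of_eq ?_⟩
    rw [netVar] at hQ
    rw [netCorr]
    field_simp
    ring
  | succ l ih =>
    have hstep (t : ℝ) (ht : |t| ≤ 1) : 1 - netCorr τ σw σb (l + 1) t ≤
        σw ^ 2 / netVar τ σw σb (l + 1) *
          (K ^ 2 * netVar τ σw σb l * (1 - netCorr τ σw σb l t)) := by
      have h := integral_sq_sub_mul_correlated_le (hτ l (by omega))
        (κ := K * √(netVar τ σw σb l)) (fun a b => by
          have := hK.dist_le_mul (√(netVar τ σw σb l) * a) (√(netVar τ σw σb l) * b)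
          rwa [Real.dist_eq, Real.dist_eq, ← mul_sub, abs_mul, abs_of_nonneg (Real.sqrt_nonneg _),
            ← mul_assoc] at this) (abs_netCorr_le_one hτ ht (show l ≤ L by omega))
      rw [mul_pow, Real.sq_sqrt (netVar_nonneg _ _ _ _)] at h
      rw [netCorr, div_mul_eq_mul_div, le_div_iff₀ hQ, sub_mul, div_mul_cancel₀ _ hQ.ne', one_mul]
      conv_lhs => enter [1]; rw [netVar]
      linarith [mul_le_mul_of_nonneg_left h (sq_nonneg σw)]
    rcases (netVar_nonneg τ σw σb l).eq_or_lt with h0 | h0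
    · exact ⟨0, fun t ht => by simpa [← h0] using hstep t ht⟩
    · obtain ⟨C, hC⟩ := ih (by omega) h0
      refine ⟨σw ^ 2 / netVar τ σw σb (l + 1) * (K ^ 2 * netVar τ σw σb l * C),
        fun t ht => (hstep t ht).trans ?_⟩
      rw [mul_assoc (σw ^ 2 / _), mul_assoc (_ * _) C]
      have := hC t ht
      gcongr

/-- The correlation function decreases at most linearly near `1`. -/
theorem exists_one_sub_netCorr_le {τ : ℝ → ℝ} {σw σb : ℝ} {L : ℕ}
    (hτ : ∀ l < L, MemLp (fun z => τ (√(netVar τ σw σb l) * z)) 2 (gaussianReal 0 1))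
    (hQ : 0 < netVar τ σw σb L)
    (h : (∃ K : ℝ≥0, LipschitzWith K τ) ∨
      DifferentiableWithinAt ℝ (netCorr τ σw σb L) (Set.Icc (-1) 1) 1) :
    ∃ C δ : ℝ, 0 < δ ∧ ∀ t ∈ Set.Icc (-1 : ℝ) 1, 1 - δ ≤ t →
      1 - netCorr τ σw σb L t ≤ C * (1 - t) := by
  rcases h with ⟨K, hK⟩ | hd
  · obtain ⟨C, hC⟩ := hK.exists_one_sub_netCorr_le hτ le_rfl hQ
    exact ⟨C, 1, one_pos, fun t ht _ => hC t (abs_le.2 ht)⟩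
  · obtain ⟨C, hC⟩ := hd.isBigO_sub.bound
    rw [eventually_nhdsWithin_iff, Metric.eventually_nhds_iff] at hC
    obtain ⟨ε, hε, hC⟩ := hC
    refine ⟨C, ε / 2, by positivity, fun t ht htδ => ?_⟩
    have hd : dist t 1 < ε := by
      rw [Real.dist_eq, abs_sub_comm, abs_of_nonneg (by linarith [ht.2])]
      linarith
    have := hC hd ht
    rw [netCorr_one hQ, Real.norm_eq_abs, Real.norm_eq_abs, abs_sub_comm, abs_sub_comm t,
      abs_of_nonneg (sub_nonneg.2 ht.2)] at this
    exact (le_abs_self _).trans this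

/-! ### Overlaps and the first flip time -/

theorem overlap_eq_one_sub_hammingDist {n : ℕ} (hn : 0 < n) (x y : BitString n) :
    overlap x y = 1 - 2 * hammingDist x y / n := by
  have hterm : ∀ i, ((x i : ℤ) : ℝ) * ((y i : ℤ) : ℝ) = 1 - 2 * if x i ≠ y i then 1 else 0 := by
    intro i
    rcases Int.units_eq_one_or (x i) with h | h <;> rcases Int.units_eq_one_or (y i) with h' | h' <;>
      simp [h, h'] <;> norm_num
  have hn' : (n : ℝ) ≠ 0 := by positivity
  rw [overlap, Finset.sum_congr rfl fun i _ => hterm i, Finset.sum_sub_distrib, ← Finset.mul_sum,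
    Finset.sum_boole, hammingDist]
  simp only [Finset.sum_const, Finset.card_univ, Fintype.card_fin, nsmul_eq_mul, mul_one]
  field_simp

theorem stepsToFlip_le {n : ℕ} (v : Fin (n + 1) → ℝ) : stepsToFlip v ≤ n :=
  Nat.sInf_le (Set.mem_insert _ _)

theorem le_stepsToFlip {n k : ℕ} {v : Fin (n + 1) → ℝ} (hk : k ≤ n)
    (h : ∀ i : Fin (n + 1), (i : ℕ) < k → 0 ≤ v 0 * v i) : k ≤ stepsToFlip v := by
  refine le_csInf ⟨n, Set.mem_insert _ _⟩ ?_
  rintro _ (rfl | ⟨i, rfl, _, hi⟩)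
  · exact hk
  · by_contra! hlt
    exact absurd (h i hlt) (not_le.2 hi)

theorem one_le_stepsToFlip {n : ℕ} (hn : 1 ≤ n) (v : Fin (n + 1) → ℝ) : 1 ≤ stepsToFlip v := by
  refine le_stepsToFlip hn fun i hi => ?_
  obtain rfl : i = 0 := Fin.ext (by simpa using hi)
  exact mul_self_nonneg _

/-- The value depends only on which products are negative, so the map factors through a finite
discrete space. -/
theorem measurable_stepsToFlip (n : ℕ) :
    Measurable (stepsToFlip : (Fin (n + 1) → ℝ) → ℕ) := by
  let G : (Fin (n + 1) → Prop) → ℕ := fun b =>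
    sInf (insert n {k | ∃ i : Fin (n + 1), (i : ℕ) = k ∧ 1 ≤ k ∧ b i})
  have hG : Measurable G := Measurable.of_discrete
  have hb : Measurable fun (v : Fin (n + 1) → ℝ) (i : Fin (n + 1)) => v 0 * v i < 0 :=
    measurable_pi_lambda _ fun i =>
      (measurableSet_lt ((measurable_pi_apply 0).mul (measurable_pi_apply i))
        measurable_const).mem
  exact hG.comp hb

theorem integrable_stepsToFlip {Ω : Type*} [MeasurableSpace Ω] {P : Measure Ω}
    [IsFiniteMeasure P] {n : ℕ} {X : Fin (n + 1) → Ω → ℝ} (hX : ∀ i, AEMeasurable (X i) P) :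
    Integrable (fun ω => (stepsToFlip fun i => X i ω : ℝ)) P := by
  have hm : AEMeasurable (fun ω => (stepsToFlip fun i => X i ω : ℝ)) P :=
    (measurable_from_top (f := ((↑) : ℕ → ℝ))).comp_aemeasurable
      ((measurable_stepsToFlip n).comp_aemeasurable (aemeasurable_pi_lambda _ hX))
  refine Integrable.of_bound hm.aestronglyMeasurable n (ae_of_all _ fun ω => ?_)
  simpa using stepsToFlip_le _

/-! ### Lower bound on the expected flip time -/

/-- A centred Gaussian process whose increments have variance at most linear in the time lag keeps
its initial sign up to time `2 ^ K` with probability at least `1 / 2`, for small enough slope. -/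
theorem two_pow_div_two_le_integral_stepsToFlip {Ω : Type*} [MeasurableSpace Ω] {P : Measure Ω}
    {n K : ℕ} {X : Fin (n + 1) → Ω → ℝ} (hX : IsGaussianProcess X P)
    (h0 : ∀ i, ∫ ω, X i ω ∂P = 0) {Q B : ℝ} (hQ : 0 < Q) (h2 : ∫ ω, X 0 ω ^ 2 ∂P = Q)
    (hinc : ∀ i j : Fin (n + 1), i ≤ j → (j - i : ℕ) ≤ 2 ^ K →
      ∫ ω, (X j ω - X i ω) ^ 2 ∂P ≤ Q * B * (j - i : ℕ))
    (hB0 : 0 ≤ B) (hK : 2 ^ K ≤ n)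
    (hB : 20000 * 256 * (∫ z, z ^ 4 ∂(gaussianReal 0 1)) * B ^ 2 * 4 ^ K ≤ 1 / 4) :
    2 ^ K / 2 ≤ ∫ ω, (stepsToFlip (fun i => X i ω) : ℝ) ∂P := by
  have := hX.isProbabilityMeasure
  set M := ∫ z, z ^ 4 ∂(gaussianReal 0 1) with hM
  have hM0 : 0 ≤ M := integral_nonneg fun z => by positivity
  -- Freezing the process after time `n` extends it to all of `ℕ`; lags can only shrink.
  let c : ℕ → Fin (n + 1) := fun i => ⟨min i n, by omega⟩
  have htail : ∀ i d : ℕ, d ≤ 2 ^ K → ∀ a : ℝ, 0 < a →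
      P.real {ω | a ≤ |X (c (i + d)) ω - X (c i) ω|} ≤ M * (Q * B) ^ 2 * d ^ 2 / a ^ 4 := by
    intro i d hd a ha
    have hlag : ((c (i + d) : ℕ) - (c i : ℕ) : ℕ) ≤ d := by
      simp only [c]
      omega
    have hmean : ∫ ω, (X (c (i + d)) ω - X (c i) ω) ∂P = 0 := by
      rw [integral_sub (hX.hasGaussianLaw_eval _).integrable (hX.hasGaussianLaw_eval _).integrable,
        h0, h0, sub_zero]
    have hvar : ∫ ω, (X (c (i + d)) ω - X (c i) ω) ^ 2 ∂P ≤ Q * B * d := by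
      refine (hinc (c i) (c (i + d)) (Fin.mk_le_mk.2 (by omega)) (hlag.trans hd)).trans ?_
      gcongr
    have hnn : 0 ≤ ∫ ω, (X (c (i + d)) ω - X (c i) ω) ^ 2 ∂P :=
      integral_nonneg fun ω => sq_nonneg _
    refine (measureReal_abs_ge_le_of_hasGaussianLaw hX.hasGaussianLaw_fun_sub hmean ha).trans ?_
    rw [mul_assoc, ← mul_pow]
    gcongr
  have hsq : 0 < √Q := Real.sqrt_pos.2 hQ
  have hfar := measureReal_exists_increment_ge_le (f := fun i => X (c i)) (by positivity) K htail 0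
    (a := 1 / 4 * √Q) (by positivity)
  have hsmall := measureReal_abs_lt_le_of_hasGaussianLaw (hX.hasGaussianLaw_eval 0) (h0 0) hQ h2
    (c := 1 / 4) (by norm_num)
  have hfar' : 20000 * (M * (Q * B) ^ 2) * 4 ^ K / (1 / 4 * √Q) ^ 4 ≤ 1 / 4 := by
    refine le_of_eq_of_le ?_ hB
    have : √Q ^ 4 = Q ^ 2 := by
      rw [show (4 : ℕ) = 2 * 2 from rfl, pow_mul, Real.sq_sqrt hQ.le]
    rw [mul_pow (1 / 4), this]
    field_simp
    norm_num
  have hcover : (Set.univ : Set Ω) ⊆ {ω | (2 : ℝ) ^ K ≤ stepsToFlip fun i => X i ω} ∪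
      ({ω | |X 0 ω| < 1 / 4 * √Q} ∪
        {ω | ∃ i < 2 ^ K, 1 / 4 * √Q ≤ |X (c (0 + i)) ω - X (c 0) ω|}) := by
    intro ω _
    by_contra hω
    simp only [Set.mem_union, not_or] at hω
    obtain ⟨hω1, hω2, hω3⟩ := hω
    refine hω1 ?_
    change ¬ |X 0 ω| < 1 / 4 * √Q at hω2
    change ¬ ∃ i < 2 ^ K, 1 / 4 * √Q ≤ |X (c (0 + i)) ω - X (c 0) ω| at hω3
    push Not at hω2 hω3
    have hle : 2 ^ K ≤ stepsToFlip fun i => X i ω := by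
      refine le_stepsToFlip hK fun i hi => ?_
      have hi' := hω3 i hi
      have hci : c (0 + i) = i := Fin.ext (by simp only [c]; omega)
      have hc0 : c 0 = 0 := Fin.ext (by simp [c])
      rw [hci, hc0] at hi'
      have hlt := hi'.trans_le hω2
      have := sq_lt_sq.2 hlt
      nlinarith [sq_nonneg (X i ω)]
    change (2 : ℝ) ^ K ≤ _
    exact_mod_cast hle
  have hprob := (measureReal_mono hcover (measure_ne_top P _)).trans
    ((measureReal_union_le _ _).trans (add_le_add_right (measureReal_union_le _ _) _))
  rw [probReal_univ] at hprob
  have hmarkov := mul_meas_ge_le_integral_of_nonneg (ae_of_all P fun ω => Nat.cast_nonneg _)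
    (integrable_stepsToFlip fun i => hX.aemeasurable i) ((2 : ℝ) ^ K)
  have hhalf : 1 / 2 ≤ P.real {ω | (2 : ℝ) ^ K ≤ stepsToFlip fun i => X i ω} := by linarith
  have : (2 : ℝ) ^ K * (1 / 2) ≤
      2 ^ K * P.real {ω | (2 : ℝ) ^ K ≤ stepsToFlip fun i => X i ω} := by gcongr
  linarith

theorem IsNetworkOutput.integral_sub_sq {τ : ℝ → ℝ} {σw σb : ℝ} {L n : ℕ} {Ω : Type*}
    [MeasurableSpace Ω] {P : Measure Ω} {φ : BitString n → Ω → ℝ}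
    (hφ : IsNetworkOutput τ σw σb L n P φ) (hn : 0 < n) (hQ : 0 < netVar τ σw σb L)
    (x y : BitString n) :
    ∫ ω, (φ x ω - φ y ω) ^ 2 ∂P =
      2 * netVar τ σw σb L * (1 - netCorr τ σw σb L (overlap x y)) := by
  have hL2 (z) : MemLp (φ z) 2 P := (hφ.gaussian.hasGaussianLaw_eval z).memLp_two
  have hI (z w) : Integrable (fun ω => φ z ω * φ w ω) P := (hL2 z).integrable_mul (hL2 w)
  have hself (z : BitString n) : overlap z z = 1 := by
    rw [overlap_eq_one_sub_hammingDist hn]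
    simp
  have hexp : ∀ ω, (φ x ω - φ y ω) ^ 2 =
      (φ x ω * φ x ω - 2 * (φ x ω * φ y ω)) + φ y ω * φ y ω := fun ω => by ring
  simp_rw [hexp]
  rw [integral_add (by exact (hI x x).sub ((hI x y).const_mul 2)) (hI y y),
    integral_sub (hI x x) ((hI x y).const_mul 2), integral_const_mul, hφ.cov, hφ.cov, hφ.cov,
    hself, hself, netCorr_one hQ]
  ring

theorem IsNetworkOutput.le_integral_stepsToFlip {τ : ℝ → ℝ} {σw σb : ℝ} {L n : ℕ} {Ω : Type*}
    [MeasurableSpace Ω] {P : Measure Ω} {φ : BitString n → Ω → ℝ} {x : Fin (n + 1) → BitString n}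
    (hφ : IsNetworkOutput τ σw σb L n P φ) (hx : IsGeodesic x) (hQ : 0 < netVar τ σw σb L)
    {C δ ε : ℝ} (hC : 0 ≤ C) (hε1 : ε ≤ 1) (hεδ : 2 * ε ≤ δ)
    (hεC : 20000 * 256 * (∫ z, z ^ 4 ∂(gaussianReal 0 1)) * (4 * C * ε) ^ 2 ≤ 1 / 4)
    (hF : ∀ t ∈ Set.Icc (-1 : ℝ) 1, 1 - δ ≤ t → 1 - netCorr τ σw σb L t ≤ C * (1 - t)) :
    n * (ε / 4) ≤ ∫ ω, (stepsToFlip (fun i => φ (x i) ω) : ℝ) ∂P := by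
  have hX : IsGaussianProcess (fun i => φ (x i)) P := hφ.gaussian.comp_right x
  have := hX.isProbabilityMeasure
  rcases Nat.eq_zero_or_pos n with rfl | hn
  · simpa using integral_nonneg fun ω => Nat.cast_nonneg _
  have hn' : (0 : ℝ) < n := by exact_mod_cast hn
  -- For `ε * n < 1` no dyadic block fits, but the flip time is always at least 1.
  rcases lt_or_ge (ε * n) 1 with hsmall | hbig
  · have h1 : (1 : ℝ) ≤ ∫ ω, (stepsToFlip (fun i => φ (x i) ω) : ℝ) ∂P := by
      have := integral_mono (integrable_const (μ := P) (1 : ℝ))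
        (integrable_stepsToFlip fun i => hX.aemeasurable i)
        fun ω => Nat.one_le_cast.2 (one_le_stepsToFlip hn _)
      simpa using this
    linarith
  obtain ⟨K, hK1, hK2⟩ := exists_nat_pow_near hbig (one_lt_two : (1 : ℝ) < 2)
  have hM0 : 0 ≤ ∫ z : ℝ, z ^ 4 ∂(gaussianReal 0 1) := integral_nonneg fun z => by positivity
  have hKn : 2 ^ K ≤ n := by
    have : (2 : ℝ) ^ K ≤ n := hK1.trans (mul_le_of_le_one_left hn'.le hε1)
    exact_mod_cast this
  have key := two_pow_div_two_le_integral_stepsToFlip (K := K) hX (fun i => hφ.mean_zero _) hQ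
    (B := 4 * C / n) ?_ ?_ (by positivity) hKn ?_
  · rw [pow_succ] at hK2
    linarith
  · have := hφ.cov (x 0) (x 0)
    rw [overlap_eq_one_sub_hammingDist hn, hammingDist_self] at this
    simpa [sq, netCorr_one hQ] using this
  · intro i j hij hd
    have hdist : hammingDist (x j) (x i) = (j - i : ℕ) := by
      have h := hx j i
      have hij' : (i : ℕ) ≤ j := hij
      rw [abs_of_nonneg (by omega)] at h
      omega
    have hdn : ((j - i : ℕ) : ℝ) ≤ ε * n :=
      le_trans (by exact_mod_cast hd) hK1
    have hdn' : ((j - i : ℕ) : ℝ) / n ≤ ε := (div_le_iff₀ hn').2 hdn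
    have hd0 : (0 : ℝ) ≤ ((j - i : ℕ) : ℝ) / n := by positivity
    have hov : overlap (x j) (x i) = 1 - 2 * (((j - i : ℕ) : ℝ) / n) := by
      rw [overlap_eq_one_sub_hammingDist hn, hdist, mul_div_assoc]
    rw [hφ.integral_sub_sq hn hQ, hov]
    have := hF (1 - 2 * (((j - i : ℕ) : ℝ) / n)) ⟨by linarith, by linarith⟩ (by linarith)
    calc _ ≤ 2 * netVar τ σw σb L * (C * (1 - (1 - 2 * (((j - i : ℕ) : ℝ) / n)))) := by gcongr
      _ = _ := by ring
  · have h4 : (4 : ℝ) ^ K = (2 ^ K) ^ 2 := by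
      rw [← pow_mul, mul_comm, pow_mul]
      norm_num
    refine le_trans ?_ hεC
    rw [mul_assoc _ _ ((4 : ℝ) ^ K), h4, ← mul_pow]
    have : 4 * C / n * 2 ^ K ≤ 4 * C * ε := by
      rw [div_mul_eq_mul_div, div_le_iff₀ hn', mul_assoc _ ε]
      gcongr
    gcongr

theorem theorem2 (F : Set.Icc (-1 : ℝ) 1 → ℝ) :
    ∃ t₀ : ℝ, 0 < t₀ ∧
      ∀ (τ : ℝ → ℝ) (σw σb : ℝ) (L : ℕ),
        Measurable τ →
        (∀ l < L, MemLp (fun z => τ (√(netVar τ σw σb l) * z)) 2 (gaussianReal 0 1)) →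
        0 < netVar τ σw σb L →
        ((∃ K : ℝ≥0, LipschitzWith K τ) ∨
          DifferentiableWithinAt ℝ (netCorr τ σw σb L) (Set.Icc (-1) 1) 1) →
        (∀ t : Set.Icc (-1 : ℝ) 1, netCorr τ σw σb L t = F t) →
        ∀ (n : ℕ) (Ω : Type*) [MeasurableSpace Ω] (P : Measure Ω) [IsProbabilityMeasure P]
          (φ : BitString n → Ω → ℝ) (x : Fin (n + 1) → BitString n),
          IsNetworkOutput τ σw σb L n P φ → IsGeodesic x →
          n * t₀ ≤ ∫ ω, (stepsToFlip (fun i => φ (x i) ω) : ℝ) ∂P := by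
  -- The constant must be chosen before the network. If `F` has no linear bound at `1`, no
  -- admissible network realizes it and any constant works.
  by_cases hF : ∃ C δ : ℝ, 0 < δ ∧ ∀ t : Set.Icc (-1 : ℝ) 1, 1 - δ ≤ t →
      1 - F t ≤ C * (1 - t)
  · obtain ⟨C, δ, hδ, hC⟩ := hF
    set M := ∫ z : ℝ, z ^ 4 ∂(gaussianReal 0 1) with hM
    have hM0 : 0 ≤ M := integral_nonneg fun z => by positivity
    set C₁ := max C 1
    have one_le_C₁ : 1 ≤ C₁ := le_max_right _ _
    have C₁_pos : 0 < C₁ := one_pos.trans_le one_le_C₁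
    -- Using `M + 1` and `C₁ ≥ 1` avoids division by zero and forces `ε ≤ 1`; the smallness
    -- condition then holds because `20000 * 256 * 16 / 20000 ^ 2 < 1 / 4`.
    set ε := min (δ / 2) (1 / (20000 * C₁ * (M + 1))) with hε
    have hε0 : 0 < ε := lt_min (by positivity) (by positivity)
    have hεb : ε * (20000 * C₁ * (M + 1)) ≤ 1 :=
      (le_div_iff₀ (by positivity)).1 (min_le_right _ _)
    refine ⟨ε / 4, by positivity, fun τ σw σb L _ _ hQ _ hτF n Ω _ P _ φ x hφ hx =>
      hφ.le_integral_stepsToFlip hx hQ C₁_pos.le ?_ (δ := δ) ?_ ?_ ?_⟩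
    · refine le_trans ?_ hεb
      apply le_mul_of_one_le_right hε0.le
      nlinarith
    · linarith [min_le_left (δ / 2) (1 / (20000 * C₁ * (M + 1)))]
    · rw [← hM]
      have h1 : (ε * (20000 * C₁ * (M + 1))) ^ 2 ≤ 1 := pow_le_one₀ (by positivity) hεb
      have h2 : M * (C₁ * ε) ^ 2 ≤ (M + 1) ^ 2 * (C₁ * ε) ^ 2 := by
        gcongr
        nlinarith
      nlinarith [sq_nonneg ((M + 1) * (C₁ * ε))]
    · intro t ht htδ
      rw [hτF ⟨t, ht⟩]
      refine (hC ⟨t, ht⟩ htδ).trans ?_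
      exact mul_le_mul_of_nonneg_right (le_max_left _ _) (sub_nonneg.2 ht.2)
  · refine ⟨1, one_pos, fun τ σw σb L _ hτ hQ h hτF => absurd ?_ hF⟩
    obtain ⟨C, δ, hδ, hC⟩ := exists_one_sub_netCorr_le hτ hQ h
    exact ⟨C, δ, hδ, fun t htδ => hτF t ▸ hC t t.2 htδ⟩
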